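/- Let $\mathrm{Ai}$ be the Airy function, $\mathrm{Ai}(z)=\frac{1}{2\pi i}\int_{1-i\infty}^{1+i\infty}\exp\left(\frac{w^3}{3}-zw\right)dw$ for $z\in\mathbb{C}$, and let $$\theta(x,t)=\exp\left(\tfrac{2}{3}t^3\right)\,\mathrm{Ai}(t^2-x),\qquad x,t\in\mathbb{C}.$$ Let $a_n=a_n(x)$ be the polynomials defined by $a_0=x$, $a_1=1$ and $$a_{n+1}=\frac{da_n}{dx}+\sum_{k=0}^{n-1}a_k\,a_{n-1-k}\qquad(n\ge 1).$$ Then $\theta$ is an entire function of two variables, and for every $x\in\mathbb{C}$ there is an asymptotic expansion $$\frac{\partial}{\partial t}\log\theta(x,t)\sim\sum_{n=0}^{\infty}a_n(x)\,(-2t)^{-n}$$ as $t\to\infty$ in any proper subsector of the sector $|\arg t|<\pi/2$. That is, for all real $\alpha,\beta$ with $-\pi/2<\alpha\le\beta<\pi/2$, one has $\theta(x,t)\neq 0$ for all sufficiently large $|t|$ with $\alpha\le\arg t\le\beta$, and for every integer $N\ge 0$, $$\frac{\partial_t\theta(x,t)}{\theta(x,t)}-\sum_{n=0}^{N}a_n(x)\,(-2t)^{-n}=o\left(|t|^{-N}\right)\qquad(|t|\to\infty,\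 \alpha\le\arg t\le\beta).$$ -/

import Mathlib

open scoped Real Polynomial Asymptotics

/-- The Airy function `Ai : ℂ → ℂ`, by its contour integral representation
`Ai(z) = (1 / 2πi) ∫ exp(w³ / 3 - z w) dw` along the upward vertical line `w = 1 + i s`, `s ∈ ℝ`
(so `dw = i ds`). On this line the integrand has modulus `exp(1/3 - s² - Re z + s Im z)`, so the
integral converges absolutely for every complex `z`. -/
noncomputable def airyAi (z : ℂ) : ℂ :=
  (1 / (2 * (π : ℂ))) *
    ∫ s : ℝ, Complex.exp ((1 + Complex.I * (s : ℂ)) ^ 3 / 3 - z * (1 + Complex.I * (s : ℂ)))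

/-- `θ(x, t) = exp(2 t³ / 3) Ai(t² - x)`. -/
noncomputable def airyTheta (x t : ℂ) : ℂ :=
  Complex.exp (2 * t ^ 3 / 3) * airyAi (t ^ 2 - x)

/-- The polynomials `a₀ = x`, `a₁ = 1`, `aₙ₊₁ = aₙ' + ∑_{k=0}^{n-1} a_k a_{n-1-k}`.
The recursion clause below is this formula at `n + 1`. -/
noncomputable def entryPoly : ℕ → ℂ[X]
  | 0 => Polynomial.X
  | 1 => 1
  | n + 2 => Polynomial.derivative (entryPoly (n + 1)) +
      ∑ k : Fin (n + 1), entryPoly k * entryPoly (n - k)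

/-- The recurrence in its usual form; it also holds for `n = 0`. -/
theorem entryPoly_succ (n : ℕ) :
    entryPoly (n + 1) = Polynomial.derivative (entryPoly n) +
      ∑ k ∈ Finset.range n, entryPoly k * entryPoly (n - 1 - k) := by
  cases n with
  | zero => simp [entryPoly]
  | succ n =>
    rw [entryPoly, Finset.sum_range]
    simp

/-- The closed sector `α ≤ arg t ≤ β` with vertex `0` (vertex excluded). -/
def closedSector (α β : ℝ) : Set ℂ :=
  {t : ℂ | t ≠ 0 ∧ α ≤ t.arg ∧ t.arg ≤ β}

/-- The filter of `t → ∞` (that is, `|t| → ∞`) within a set `S` of complex numbers. -/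
noncomputable def toInfinityWithin (S : Set ℂ) : Filter ℂ :=
  Bornology.cobounded ℂ ⊓ Filter.principal S

/-- Poincaré asymptotic expansion `f ∼ ∑ cₙ φₙ` along a filter `l`, with respect to the asymptotic
scale `φ`: for every `N`, `f - ∑_{n=0}^{N} cₙ φₙ = o(φ_N)`. -/
def HasAsymptoticExpansion (l : Filter ℂ) (f : ℂ → ℂ) (c : ℕ → ℂ) (φ : ℕ → ℂ → ℂ) : Prop :=
  ∀ N : ℕ, (fun t => f t - ∑ n ∈ Finset.range (N + 1), c n * φ n t) =o[l] φ N

/-!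
Moving the line of integration in the Airy integral so that it passes through the saddle point
`w = t` turns `θ` into a Gaussian-type integral, valid for `0 < Re t`
(`airyTheta_eq_airyMoment`):
`θ(x, t) = exp (x t) / (2π) * ∫ exp (-t s² + i x s - i s³ / 3) ds`.
The shift needs no contour theorem: as a function of a complex base point `c` of the line, the
integral has derivative zero on the right half plane (`exp_mul_airyMoment_eq`).

Write `G_k` for the `k`-th moment of the same integrand. Then `u = ∂ₜ log θ` equals `x - G₂ / G₀`,
and differentiation under the integral together with one integration by parts gives the Riccati
equation `u = x + τ ∂ₓu + τ² u²`, where `τ = (-2t)⁻¹` (`thetaLogDeriv_riccati`). Its formal solution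
in powers of `τ` is `∑ aₙ(x) τⁿ`; that is exactly the recursion for the `aₙ`
(`X_pow_dvd_riccati_entrySum`).

A closed subsector of `|arg t| < π / 2` lies in a cone `δ |t| ≤ Re t`. There the substitution
`s = σ / √|t|` shows that `G₀` is `√(π / t) + O(1 / |t|)` and `G₂` is `O(|t|^(-1/2))`, uniformly for
bounded `x`. So `θ` has no zeros for large `|t|`, and `u` is bounded, locally uniformly in `x`
(`exists_norm_thetaLogDeriv_le`). This crude bound is enough. Suppose that `u` agrees with its
`n`-term expansion up to `O(τⁿ)`, locally uniformly in `x`. Cauchy's estimate bounds the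
`x`-derivative of the remainder by the same order, and the right-hand side of the Riccati equation
gains a factor `τ`, so the `(n + 1)`-term expansion holds up to `O(τⁿ⁺¹)`
(`exists_norm_thetaLogDeriv_sub_le`).
-/

/-! ### The oscillatory Gaussian moments -/

/-- The Gaussian weight `exp (-a s² + b s)` times the oscillating factor `exp (-i s³ / 3)`. -/
noncomputable def airyKernel (a b : ℂ) (s : ℝ) : ℂ :=
  Complex.exp (-a * (s : ℂ) ^ 2 + b * s - Complex.I * (s : ℂ) ^ 3 / 3)

/-- The `k`-th moment `∫ sᵏ exp (-a s² + b s - i s³ / 3) ds`. It is only used for `0 < Re a`, where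
the integral converges absolutely. -/
noncomputable def airyMoment (k : ℕ) (a b : ℂ) : ℂ :=
  ∫ s : ℝ, (s : ℂ) ^ k * airyKernel a b s

theorem continuous_airyKernel (a b : ℂ) : Continuous (airyKernel a b) := by
  unfold airyKernel; fun_prop

theorem norm_airyKernel (a b : ℂ) (s : ℝ) :
    ‖airyKernel a b s‖ = Real.exp (-a.re * s ^ 2 + b.re * s) := by
  rw [airyKernel, Complex.norm_exp]
  have : -a * (s : ℂ) ^ 2 + b * s - Complex.I * (s : ℂ) ^ 3 / 3
      = -a * ((s ^ 2 : ℝ) : ℂ) + b * s - Complex.I * ((s ^ 3 / 3 : ℝ) : ℂ) := by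
    push_cast; ring
  rw [this]
  simp only [Complex.sub_re, Complex.add_re, Complex.re_mul_ofReal, Complex.neg_re, Complex.I_re]
  ring_nf

theorem norm_airyKernel_le {a b : ℂ} {δ B : ℝ} (ha : δ ≤ a.re) (hb : ‖b‖ ≤ B) (s : ℝ) :
    ‖airyKernel a b s‖ ≤ Real.exp (-δ * s ^ 2 + B * |s|) := by
  rw [norm_airyKernel, Real.exp_le_exp]
  have h1 : b.re * s ≤ B * |s| := calc
    b.re * s ≤ |b.re * s| := le_abs_self _
    _ = |b.re| * |s| := abs_mul _ _
    _ ≤ B * |s| := by gcongr; exact (Complex.abs_re_le_norm b).trans hb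
  nlinarith [mul_le_mul_of_nonneg_right ha (sq_nonneg s)]

theorem integrable_abs_pow_mul_exp (k : ℕ) {δ : ℝ} (hδ : 0 < δ) (B : ℝ) :
    MeasureTheory.Integrable fun s : ℝ => |s| ^ k * Real.exp (-δ * s ^ 2 + B * |s|) := by
  have h := (integrable_rpow_mul_exp_neg_mul_sq (half_pos hδ) (s := k)
    (by have : (0 : ℝ) ≤ k := by positivity
        linarith)).norm.const_mul (Real.exp (B ^ 2 / (2 * δ)))
  refine h.mono' (by fun_prop) (Filter.Eventually.of_forall fun s => ?_)
  rw [Real.norm_of_nonneg (by positivity), Real.rpow_natCast, norm_mul, norm_pow, Real.norm_eq_abs,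
    Real.norm_of_nonneg (Real.exp_pos _).le, mul_left_comm, ← Real.exp_add]
  refine mul_le_mul_of_nonneg_left (Real.exp_le_exp.2 ?_) (by positivity)
  -- complete the square: `B |s| ≤ δ s² / 2 + B² / (2 δ)`
  have h2 : B ^ 2 / (2 * δ) + -(δ / 2) * s ^ 2 - (-δ * s ^ 2 + B * |s|)
      = (B - δ * |s|) ^ 2 / (2 * δ) := by
    rw [← sq_abs s]; field_simp; ring
  have h3 : 0 ≤ (B - δ * |s|) ^ 2 / (2 * δ) := by positivity
  linarith

theorem integrable_pow_mul_airyKernel (k : ℕ) {a : ℂ} (ha : 0 < a.re) (b : ℂ) :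
    MeasureTheory.Integrable fun s : ℝ => (s : ℂ) ^ k * airyKernel a b s := by
  refine (integrable_abs_pow_mul_exp k ha ‖b‖).mono'
    (((by fun_prop : Continuous fun s : ℝ => (s : ℂ) ^ k).mul
      (continuous_airyKernel a b)).aestronglyMeasurable) (Filter.Eventually.of_forall fun s => ?_)
  rw [norm_mul, norm_pow, Complex.norm_real, Real.norm_eq_abs]
  gcongr
  exact norm_airyKernel_le le_rfl le_rfl s

theorem hasFDerivAt_airyKernel (s : ℝ) (p : ℂ × ℂ) :
    HasFDerivAt (fun p : ℂ × ℂ => airyKernel p.1 p.2 s)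
      (airyKernel p.1 p.2 s • (-((s : ℂ) ^ 2) • ContinuousLinearMap.fst ℂ ℂ ℂ +
        (s : ℂ) • ContinuousLinearMap.snd ℂ ℂ ℂ)) p := by
  unfold airyKernel
  apply HasFDerivAt.cexp
  have h1 : HasFDerivAt (fun p : ℂ × ℂ => p.1) (ContinuousLinearMap.fst ℂ ℂ ℂ) p := hasFDerivAt_fst
  have h2 : HasFDerivAt (fun p : ℂ × ℂ => p.2) (ContinuousLinearMap.snd ℂ ℂ ℂ) p := hasFDerivAt_snd
  convert! ((h1.neg.mul_const ((s : ℂ) ^ 2)).add (h2.mul_const (s : ℂ))).sub_const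
    (Complex.I * (s : ℂ) ^ 3 / 3) using 1
  ext <;> simp

theorem hasFDerivAt_airyMoment (k : ℕ) {p : ℂ × ℂ} (hp : 0 < p.1.re) :
    HasFDerivAt (fun p : ℂ × ℂ => airyMoment k p.1 p.2)
      (-airyMoment (k + 2) p.1 p.2 • ContinuousLinearMap.fst ℂ ℂ ℂ +
        airyMoment (k + 1) p.1 p.2 • ContinuousLinearMap.snd ℂ ℂ ℂ) p := by
  set δ := p.1.re / 2
  have hδ : 0 < δ := half_pos hp
  set B := ‖p.2‖ + 1
  have hU : {q : ℂ × ℂ | δ < q.1.re ∧ ‖q.2‖ < B} ∈ nhds p := by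
    apply IsOpen.mem_nhds
    · exact (isOpen_lt continuous_const (Complex.continuous_re.comp continuous_fst)).inter
        (isOpen_lt continuous_snd.norm continuous_const)
    · exact ⟨half_lt_self hp, lt_add_one _⟩
  have key := hasFDerivAt_integral_of_dominated_of_fderiv_le (μ := MeasureTheory.volume)
    (F := fun (q : ℂ × ℂ) (s : ℝ) => (s : ℂ) ^ k * airyKernel q.1 q.2 s)
    (F' := fun (q : ℂ × ℂ) (s : ℝ) =>
      -((s : ℂ) ^ (k + 2) * airyKernel q.1 q.2 s) • ContinuousLinearMap.fst ℂ ℂ ℂ +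
        ((s : ℂ) ^ (k + 1) * airyKernel q.1 q.2 s) • ContinuousLinearMap.snd ℂ ℂ ℂ)
    (bound := fun s => |s| ^ (k + 2) * Real.exp (-δ * s ^ 2 + B * |s|) +
      |s| ^ (k + 1) * Real.exp (-δ * s ^ 2 + B * |s|)) hU
    (Filter.Eventually.of_forall fun q =>
      ((by fun_prop : Continuous fun s : ℝ => (s : ℂ) ^ k).mul
        (continuous_airyKernel q.1 q.2)).aestronglyMeasurable)
    (integrable_pow_mul_airyKernel k hp p.2) ?_ ?_
    ((integrable_abs_pow_mul_exp _ hδ B).add (integrable_abs_pow_mul_exp _ hδ B)) ?_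
  · convert! key using 1
    have i1 := integrable_pow_mul_airyKernel (k + 1) hp p.2
    have i2 := integrable_pow_mul_airyKernel (k + 2) hp p.2
    refine Eq.trans ?_ (MeasureTheory.integral_add (i2.neg.smul_const _) (i1.smul_const _)).symm
    simp only [Pi.neg_apply]
    rw [integral_smul_const, integral_smul_const, MeasureTheory.integral_neg]
    rfl
  · have := continuous_airyKernel p.1 p.2
    exact Continuous.aestronglyMeasurable (by fun_prop)
  · refine Filter.Eventually.of_forall fun s q hq => ?_
    have hK := norm_airyKernel_le hq.1.le hq.2.le s
    refine (norm_add_le _ _).trans (add_le_add ?_ ?_)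
    · rw [norm_smul, norm_neg, norm_mul, norm_pow, Complex.norm_real, Real.norm_eq_abs, mul_assoc]
      gcongr
      exact (mul_le_of_le_one_right (norm_nonneg _) (ContinuousLinearMap.norm_fst_le ..)).trans hK
    · rw [norm_smul, norm_mul, norm_pow, Complex.norm_real, Real.norm_eq_abs, mul_assoc]
      gcongr
      exact (mul_le_of_le_one_right (norm_nonneg _) (ContinuousLinearMap.norm_snd_le ..)).trans hK
  · refine Filter.Eventually.of_forall fun s q _ => ?_
    convert! (hasFDerivAt_airyKernel s q).const_mul ((s : ℂ) ^ k) using 1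
    ext <;> simp <;> ring

/-- Derivative of a moment along a curve `c ↦ (a c, b c)`. -/
theorem hasDerivAt_airyMoment_comp (k : ℕ) {a b : ℂ → ℂ} {a' b' c : ℂ} (ha : HasDerivAt a a' c)
    (hb : HasDerivAt b b' c) (hc : 0 < (a c).re) :
    HasDerivAt (fun c => airyMoment k (a c) (b c))
      (-airyMoment (k + 2) (a c) (b c) * a' + airyMoment (k + 1) (a c) (b c) * b') c := by
  have := (hasFDerivAt_airyMoment k (p := (a c, b c)) hc).comp_hasDerivAt c (ha.prodMk hb)
  convert! this using 1

/-- The integral of the `s`-derivative of the kernel vanishes. -/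
theorem airyMoment_integration_by_parts {a : ℂ} (ha : 0 < a.re) (b : ℂ) :
    -2 * a * airyMoment 1 a b + b * airyMoment 0 a b - Complex.I * airyMoment 2 a b = 0 := by
  have i0 := integrable_pow_mul_airyKernel 0 ha b
  have i1 := integrable_pow_mul_airyKernel 1 ha b
  have i2 := integrable_pow_mul_airyKernel 2 ha b
  have j := ((i1.const_mul (-2 * a)).add (i0.const_mul b)).sub (i2.const_mul Complex.I)
  have key := MeasureTheory.integral_eq_zero_of_hasDerivAt_of_integrable
    (f := airyKernel a b) (fun s => ?_) j (by simpa using i0)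
  · rw [← key]
    refine Eq.trans ?_ (MeasureTheory.integral_sub ((i1.const_mul (-2 * a)).add (i0.const_mul b))
      (i2.const_mul Complex.I)).symm
    refine Eq.trans ?_ (congrArg (· - _) (MeasureTheory.integral_add (i1.const_mul (-2 * a))
      (i0.const_mul b)).symm)
    simp only [MeasureTheory.integral_const_mul]
    rfl
  · have hs : HasDerivAt (fun s : ℝ => (s : ℂ)) 1 s := Complex.ofRealCLM.hasDerivAt
    have := (((hs.pow 2).const_mul (-a)).add (hs.const_mul b)).sub
      (((hs.pow 3).const_mul Complex.I).div_const 3)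
    convert! this.cexp using 1
    simp only [Pi.sub_apply, Pi.add_apply, Pi.pow_apply, airyKernel]
    push_cast
    ring

/-! ### The Airy function through the moments -/

/-- On the line `w = 1 + i s` the exponent is
`w³ / 3 - z w = 1 / 3 - z - s² + i (1 - z) s - i s³ / 3`. -/
theorem airyAi_eq_airyMoment (z : ℂ) :
    airyAi z = 1 / (2 * (π : ℂ)) *
      (Complex.exp (1 / 3 - z) * airyMoment 0 1 (Complex.I * (1 - z))) := by
  rw [airyAi, airyMoment, ← MeasureTheory.integral_const_mul (Complex.exp (1 / 3 - z))]
  refine congrArg (1 / (2 * (π : ℂ)) * ·)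
    (MeasureTheory.integral_congr_ae (Filter.Eventually.of_forall fun s => ?_))
  beta_reduce
  rw [airyKernel, pow_zero, one_mul, ← Complex.exp_add]
  congr 1
  linear_combination ((s : ℂ) ^ 2 + Complex.I * (s : ℂ) ^ 3 / 3) * Complex.I_sq

/-- Shifting the vertical line of integration of `exp (w³ / 3 - z w)` within the right half plane
does not change the integral: the left-hand side is the integral over `w = c + i s`, and its
derivative in `c` is the integral of a total `s`-derivative. -/
theorem exp_mul_airyMoment_eq (z : ℂ) {c : ℂ} (hc : 0 < c.re) :
    Complex.exp (c ^ 3 / 3 - z * c) * airyMoment 0 c (Complex.I * (c ^ 2 - z)) =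
      Complex.exp (1 / 3 - z) * airyMoment 0 1 (Complex.I * (1 - z)) := by
  have hd : ∀ w : ℂ, 0 < w.re → HasDerivAt (fun c : ℂ => Complex.exp (c ^ 3 / 3 - z * c) *
      airyMoment 0 c (Complex.I * (c ^ 2 - z))) 0 w := by
    intro w hw
    have h1 := (((hasDerivAt_pow 3 w).div_const 3).sub ((hasDerivAt_id w).const_mul z)).cexp
    have h2 := hasDerivAt_airyMoment_comp 0 (hasDerivAt_id w)
      (((hasDerivAt_pow 2 w).sub_const z).const_mul Complex.I) hw
    convert! h1.mul h2 using 1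
    have h3 := airyMoment_integration_by_parts hw (Complex.I * (w ^ 2 - z))
    simp only [Pi.sub_apply, id]
    push_cast
    linear_combination Complex.exp (w ^ 3 / 3 - z * w) * (Complex.I * h3 +
      (airyMoment 2 w (Complex.I * (w ^ 2 - z)) - (w ^ 2 - z) *
        airyMoment 0 w (Complex.I * (w ^ 2 - z))) * Complex.I_sq)
  have := (isOpen_lt continuous_const Complex.continuous_re).is_const_of_deriv_eq_zero
    (convex_halfSpace_re_gt 0).isPreconnected
    (fun w hw => (hd w hw).differentiableAt.differentiableWithinAt)
    (fun w hw => (hd w hw).deriv) hc (y := 1) (by simp)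
  simpa using this

/-- With the line of integration through the saddle point `w = t` of `w³ / 3 - t² w`, the factor
`exp (2 t³ / 3)` cancels and `θ` becomes a Gaussian-type integral. -/
theorem airyTheta_eq_airyMoment (x : ℂ) {t : ℂ} (ht : 0 < t.re) :
    airyTheta x t =
      1 / (2 * (π : ℂ)) * (Complex.exp (x * t) * airyMoment 0 t (Complex.I * x)) := by
  rw [airyTheta, airyAi_eq_airyMoment, ← exp_mul_airyMoment_eq (t ^ 2 - x) ht, mul_left_comm,
    ← mul_assoc (Complex.exp _), ← Complex.exp_add]
  ring_nf

theorem differentiable_airyAi : Differentiable ℂ airyAi := by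
  intro z
  have h : DifferentiableAt ℂ (fun z => airyMoment 0 1 (Complex.I * (1 - z))) z :=
    (hasDerivAt_airyMoment_comp 0 (hasDerivAt_const z 1)
      (((hasDerivAt_id z).const_sub 1).const_mul Complex.I) (by simp)).differentiableAt
  rw [show airyAi = _ from funext airyAi_eq_airyMoment]
  fun_prop

theorem differentiable_airyTheta : Differentiable ℂ (fun p : ℂ × ℂ => airyTheta p.1 p.2) := by
  unfold airyTheta
  have := differentiable_airyAi
  fun_prop

/-- The value of `∂ₜ log θ (x, t)` for `0 < Re t`, as a function of `t` first and `x` second. Where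
`airyMoment 0` vanishes it has the junk value `x`. -/
noncomputable def thetaLogDeriv (t x : ℂ) : ℂ :=
  x - airyMoment 2 t (Complex.I * x) / airyMoment 0 t (Complex.I * x)

theorem logDeriv_airyTheta (x : ℂ) {t : ℂ} (ht : 0 < t.re)
    (h0 : airyMoment 0 t (Complex.I * x) ≠ 0) :
    logDeriv (fun u => airyTheta x u) t = thetaLogDeriv t x := by
  have he : (fun u => airyTheta x u) =ᶠ[nhds t] fun u =>
      1 / (2 * (π : ℂ)) * (Complex.exp (x * u) * airyMoment 0 u (Complex.I * x)) :=
    (isOpen_lt continuous_const Complex.continuous_re).eventually_mem ht |>.mono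
      fun u hu => airyTheta_eq_airyMoment x hu
  have h1 := ((hasDerivAt_id t).const_mul x).cexp
  have h2 := hasDerivAt_airyMoment_comp 0 (hasDerivAt_id t) (hasDerivAt_const t (Complex.I * x)) ht
  have h3 : HasDerivAt
      (fun u => 1 / (2 * (π : ℂ)) * (Complex.exp (x * u) * airyMoment 0 u (Complex.I * x))) _ t :=
    (h1.mul h2).const_mul (1 / (2 * (π : ℂ)))
  have hpi : (π : ℂ) ≠ 0 := by exact_mod_cast Real.pi_ne_zero
  rw [logDeriv_apply, he.deriv_eq, he.eq_of_nhds, h3.deriv, thetaLogDeriv]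
  have := Complex.exp_ne_zero (x * t)
  simp only [id, zero_add] at *
  generalize airyMoment 0 t (Complex.I * x) = m₀ at *
  field_simp
  ring

/-- The Riccati equation `u = x + τ ∂ₓu + τ² u²` with `τ = (-2t)⁻¹`, for `u = ∂ₜ log θ`. -/
theorem thetaLogDeriv_riccati {t x : ℂ} (ht : 0 < t.re)
    (h0 : airyMoment 0 t (Complex.I * x) ≠ 0) :
    DifferentiableAt ℂ (thetaLogDeriv t) x ∧
      thetaLogDeriv t x = x + (-2 * t)⁻¹ * deriv (thetaLogDeriv t) x +
        (-2 * t)⁻¹ ^ 2 * thetaLogDeriv t x ^ 2 := by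
  have ht0 : t ≠ 0 := by rintro rfl; simp at ht
  have hx : HasDerivAt (fun x => Complex.I * x) Complex.I x := by
    simpa using (hasDerivAt_id x).const_mul Complex.I
  have d0 := hasDerivAt_airyMoment_comp 0 (hasDerivAt_const x t) hx ht
  have d1 := hasDerivAt_airyMoment_comp 1 (hasDerivAt_const x t) hx ht
  -- by parts, `u = -2 i t G₁ / G₀`, which only needs moments up to the second after one derivative
  have hu : ∀ y, airyMoment 0 t (Complex.I * y) ≠ 0 → thetaLogDeriv t y =
      -2 * Complex.I * t * (airyMoment 1 t (Complex.I * y) / airyMoment 0 t (Complex.I * y)) := by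
    intro y hy
    have := airyMoment_integration_by_parts ht (Complex.I * y)
    rw [thetaLogDeriv]
    generalize airyMoment 0 t (Complex.I * y) = m₀ at *
    generalize airyMoment 1 t (Complex.I * y) = m₁ at *
    generalize airyMoment 2 t (Complex.I * y) = m₂ at *
    field_simp
    linear_combination -Complex.I * this +
      (y * m₀ - m₂) * Complex.I_sq
  have he : thetaLogDeriv t =ᶠ[nhds x] fun y =>
      -2 * Complex.I * t * (airyMoment 1 t (Complex.I * y) / airyMoment 0 t (Complex.I * y)) :=
    (d0.continuousAt.eventually_ne h0).mono hu
  have hd := ((d1.div d0 h0).const_mul (-2 * Complex.I * t)).congr_of_eventuallyEq he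
  refine ⟨hd.differentiableAt, ?_⟩
  have := airyMoment_integration_by_parts ht (Complex.I * x)
  rw [hd.deriv, hu x h0]
  simp only [zero_add, mul_zero, one_add_one_eq_two]
  generalize airyMoment 0 t (Complex.I * x) = m₀ at *
  generalize airyMoment 1 t (Complex.I * x) = m₁ at *
  generalize airyMoment 2 t (Complex.I * x) = m₂ at *
  field_simp
  linear_combination Complex.I * m₀ * this - x * m₀ ^ 2 * Complex.I_sq

/-! ### Large parameter bounds in a sector -/

theorem exp_sq_le_exp_scaled {δ B r : ℝ} (hB : 0 ≤ B) (hr : 1 ≤ r) (s : ℝ) :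
    Real.exp (-(δ * r ^ 2) * s ^ 2 + B * |s|) ≤ Real.exp (-δ * (r * s) ^ 2 + B * |r * s|) := by
  rw [Real.exp_le_exp, abs_mul, abs_of_nonneg (zero_le_one.trans hr)]
  have : B * |s| ≤ B * (r * |s|) := by
    gcongr; exact le_mul_of_one_le_left (abs_nonneg s) hr
  nlinarith

/-- The moments are `O(|t|^(-1/2))` in sectors `δ |t| ≤ Re t`, by the substitution
`s = σ / √|t|`. -/
theorem exists_norm_airyMoment_le (k : ℕ) {δ B : ℝ} (hδ : 0 < δ) (hB : 0 ≤ B) :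
    ∃ K, ∀ t b : ℂ, 1 ≤ ‖t‖ → δ * ‖t‖ ≤ t.re → ‖b‖ ≤ B →
      ‖airyMoment k t b‖ ≤ K / √‖t‖ := by
  refine ⟨∫ σ : ℝ, |σ| ^ k * Real.exp (-δ * σ ^ 2 + B * |σ|), fun t b ht1 ht hb => ?_⟩
  set r := √‖t‖
  have hr : 1 ≤ r := Real.one_le_sqrt.2 ht1
  have hr2 : r ^ 2 = ‖t‖ := Real.sq_sqrt (norm_nonneg t)
  have hi := (integrable_abs_pow_mul_exp k hδ B).comp_mul_left' (R := r) (by positivity)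
  refine (MeasureTheory.norm_integral_le_of_norm_le hi
    (Filter.Eventually.of_forall fun s => ?_)).trans_eq ?_
  · rw [norm_mul, norm_pow, Complex.norm_real, Real.norm_eq_abs]
    gcongr ?_ * ?_
    · rw [abs_mul, abs_of_nonneg (zero_le_one.trans hr)]
      gcongr
      exact le_mul_of_one_le_left (abs_nonneg s) hr
    · exact (norm_airyKernel_le (hr2 ▸ ht) hb s).trans (exp_sq_le_exp_scaled hB hr s)
  · rw [MeasureTheory.Measure.integral_comp_mul_left
      (fun σ : ℝ => |σ| ^ k * Real.exp (-δ * σ ^ 2 + B * |σ|)), smul_eq_mul,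
      abs_of_pos (by positivity)]
    ring

theorem norm_cexp_sub_one_le {b : ℂ} {B : ℝ} (hb : ‖b‖ ≤ B) (s : ℝ) :
    ‖Complex.exp (b * s - Complex.I * (s : ℂ) ^ 3 / 3) - 1‖ ≤
      (B * |s| + |s| ^ 3) * Real.exp (B * |s|) := by
  have hB : 0 ≤ B := (norm_nonneg b).trans hb
  have hw : Complex.exp (b * s - Complex.I * (s : ℂ) ^ 3 / 3) - 1 =
      (Complex.exp (b * s) - 1) * Complex.exp (((-s ^ 3 / 3 : ℝ) : ℂ) * Complex.I) +
        (Complex.exp (Complex.I * ((-s ^ 3 / 3 : ℝ) : ℂ)) - 1) := by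
    rw [sub_mul, ← Complex.exp_add, mul_comm Complex.I]
    push_cast
    ring_nf
  have h1 : ‖Complex.exp (b * s) - 1‖ ≤ B * |s| * Real.exp (B * |s|) := by
    have := Complex.norm_exp_sub_sum_le_norm_mul_exp (b * s) 1
    simp only [Finset.range_one, Finset.sum_singleton, pow_zero, Nat.factorial_zero, Nat.cast_one,
      div_one, pow_one] at this
    have h : ‖b * (s : ℂ)‖ ≤ B * |s| := by
      rw [norm_mul, Complex.norm_real, Real.norm_eq_abs]; gcongr
    exact this.trans (by gcongr)
  have h2 : ‖Complex.exp (Complex.I * ((-s ^ 3 / 3 : ℝ) : ℂ)) - 1‖ ≤ |s| ^ 3 := by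
    refine Real.norm_exp_I_mul_ofReal_sub_one_le.trans ?_
    rw [norm_div, norm_neg, norm_pow, Real.norm_eq_abs]
    norm_num
    have := pow_nonneg (abs_nonneg s) 3
    linarith
  have h3 : |s| ^ 3 ≤ |s| ^ 3 * Real.exp (B * |s|) :=
    le_mul_of_one_le_right (by positivity) (Real.one_le_exp (by positivity))
  rw [hw]
  refine (norm_add_le _ _).trans ?_
  rw [norm_mul, Complex.norm_exp_ofReal_mul_I, mul_one]
  linarith

/-- The zeroth moment agrees with the Gaussian integral `√(π / t)` up to `O(1 / |t|)`. -/
theorem exists_norm_airyMoment_zero_sub_le {δ B : ℝ} (hδ : 0 < δ) (hB : 0 ≤ B) :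
    ∃ K, ∀ t b : ℂ, 1 ≤ ‖t‖ → δ * ‖t‖ ≤ t.re → ‖b‖ ≤ B →
      ‖airyMoment 0 t b - ((π : ℂ) / t) ^ (1 / 2 : ℂ)‖ ≤ K / ‖t‖ := by
  set h : ℝ → ℝ := fun σ => B * (|σ| ^ 1 * Real.exp (-δ * σ ^ 2 + B * |σ|)) +
    |σ| ^ 3 * Real.exp (-δ * σ ^ 2 + B * |σ|) with hh
  have hint : MeasureTheory.Integrable h :=
    ((integrable_abs_pow_mul_exp 1 hδ B).const_mul B).add (integrable_abs_pow_mul_exp 3 hδ B)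
  refine ⟨∫ σ : ℝ, h σ, fun t b ht1 ht hb => ?_⟩
  set r := √‖t‖
  have hr : 1 ≤ r := Real.one_le_sqrt.2 ht1
  have hr2 : r ^ 2 = ‖t‖ := Real.sq_sqrt (norm_nonneg t)
  have htre : 0 < t.re := lt_of_lt_of_le (by positivity) ht
  rw [← integral_gaussian_complex htre, airyMoment, ← MeasureTheory.integral_sub
    (integrable_pow_mul_airyKernel 0 htre b) (integrable_cexp_neg_mul_sq htre)]
  have hi := (hint.comp_mul_left' (R := r) (by positivity)).const_mul r⁻¹
  refine (MeasureTheory.norm_integral_le_of_norm_le hi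
    (Filter.Eventually.of_forall fun s => ?_)).trans_eq ?_
  · have e : (s : ℂ) ^ 0 * airyKernel t b s - Complex.exp (-t * (s : ℂ) ^ 2) =
        Complex.exp (-t * (s : ℂ) ^ 2) *
          (Complex.exp (b * s - Complex.I * (s : ℂ) ^ 3 / 3) - 1) := by
      rw [pow_zero, one_mul, mul_sub, ← Complex.exp_add, mul_one, airyKernel]
      ring_nf
    have hE : ‖Complex.exp (-t * (s : ℂ) ^ 2)‖ ≤ Real.exp (-(δ * r ^ 2) * s ^ 2) := by
      rw [norm_cexp_neg_mul_sq, Real.exp_le_exp, hr2]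
      nlinarith [mul_le_mul_of_nonneg_right ht (sq_nonneg s)]
    have hP : B * |s| + |s| ^ 3 ≤ r⁻¹ * (B * |r * s| + |r * s| ^ 3) := by
      rw [abs_mul, abs_of_nonneg (zero_le_one.trans hr)]
      have : r⁻¹ * (B * (r * |s|) + (r * |s|) ^ 3) = B * |s| + r ^ 2 * |s| ^ 3 := by
        field_simp
      rw [this]
      gcongr
      exact le_mul_of_one_le_left (by positivity) (one_le_pow₀ hr)
    rw [e, norm_mul]
    calc _ ≤ Real.exp (-(δ * r ^ 2) * s ^ 2) * ((B * |s| + |s| ^ 3) * Real.exp (B * |s|)) := by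
          gcongr
          exact norm_cexp_sub_one_le hb s
      _ = (B * |s| + |s| ^ 3) * Real.exp (-(δ * r ^ 2) * s ^ 2 + B * |s|) := by
          rw [Real.exp_add]; ring
      _ ≤ r⁻¹ * (B * |r * s| + |r * s| ^ 3) * Real.exp (-δ * (r * s) ^ 2 + B * |r * s|) := by
          exact mul_le_mul hP (exp_sq_le_exp_scaled hB hr s) (by positivity) (by positivity)
      _ = r⁻¹ * h (r * s) := by rw [hh]; ring
  · rw [MeasureTheory.integral_const_mul, MeasureTheory.Measure.integral_comp_mul_left h,
      smul_eq_mul, abs_of_pos (by positivity), ← hr2]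
    field_simp

/-- In a sector `δ |t| ≤ Re t`, for large `|t|`, the zeroth moment does not vanish and the
logarithmic derivative is bounded, uniformly for bounded `x`. -/
theorem exists_norm_thetaLogDeriv_le {δ : ℝ} (hδ : 0 < δ) {ρ : ℝ} (hρ : 0 ≤ ρ) :
    ∃ R M : ℝ, ∀ t x : ℂ, R ≤ ‖t‖ → δ * ‖t‖ ≤ t.re → ‖x‖ ≤ ρ →
      airyMoment 0 t (Complex.I * x) ≠ 0 ∧ ‖thetaLogDeriv t x‖ ≤ M := by
  obtain ⟨K, hK⟩ := exists_norm_airyMoment_zero_sub_le hδ hρ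
  obtain ⟨K₂, hK₂⟩ := exists_norm_airyMoment_le 2 hδ hρ
  refine ⟨max 1 ((2 * K) ^ 2), ρ + K₂, fun t x hR ht hx => ?_⟩
  have hb : ‖Complex.I * x‖ ≤ ρ := by simpa using hx
  have ht1 : 1 ≤ ‖t‖ := (le_max_left _ _).trans hR
  have h0 := hK t _ ht1 ht hb
  have h2 := hK₂ t _ ht1 ht hb
  have hr : 1 ≤ √‖t‖ := Real.one_le_sqrt.2 ht1
  have hrK : 2 * K ≤ √‖t‖ := Real.le_sqrt_of_sq_le ((le_max_right _ _).trans hR)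
  have hr2 : √‖t‖ ^ 2 = ‖t‖ := Real.sq_sqrt (norm_nonneg t)
  have hg : 3 / 2 / √‖t‖ ≤ ‖((π : ℂ) / t) ^ (1 / 2 : ℂ)‖ := by
    have h : ((1 / 2 : ℂ)) = ((1 / 2 : ℝ) : ℂ) := by push_cast; rfl
    rw [h, Complex.norm_cpow_real, ← Real.sqrt_eq_rpow, norm_div, Complex.norm_real,
      Real.norm_of_nonneg Real.pi_pos.le, Real.sqrt_div Real.pi_pos.le]
    gcongr
    exact Real.le_sqrt_of_sq_le (by linarith [Real.pi_gt_three])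
  have hl : 1 / √‖t‖ ≤ ‖airyMoment 0 t (Complex.I * x)‖ := by
    have h3 : K / ‖t‖ ≤ 1 / 2 / √‖t‖ := by
      rw [div_le_div_iff₀ (by positivity) (by positivity)]
      nlinarith
    have h4 := norm_sub_norm_le (((π : ℂ) / t) ^ (1 / 2 : ℂ)) (airyMoment 0 t (Complex.I * x))
    rw [norm_sub_rev] at h4
    have h5 : 1 / √‖t‖ = 3 / 2 / √‖t‖ - 1 / 2 / √‖t‖ := by ring
    linarith
  have hpos : 0 < ‖airyMoment 0 t (Complex.I * x)‖ := lt_of_lt_of_le (by positivity) hl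
  refine ⟨norm_pos_iff.1 hpos, (norm_sub_le _ _).trans (add_le_add hx ?_)⟩
  rw [norm_div, div_le_iff₀ hpos]
  have hK0 : 0 ≤ K₂ := by
    have := (norm_nonneg _).trans h2
    rw [div_nonneg_iff] at this
    rcases this with h | h
    · exact h.1
    · linarith [h.2]
  calc _ ≤ K₂ / √‖t‖ := h2
    _ = K₂ * (1 / √‖t‖) := by ring
    _ ≤ _ := by gcongr

/-! ### The truncated expansion and its recursion -/

open Polynomial in
/-- The bivariate polynomial `∑_{k < n} a_k(x) τᵏ`; the outer variable is `τ`, the coefficients are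
polynomials in `x`. -/
noncomputable def entrySum (n : ℕ) : ℂ[X][X] :=
  ∑ k ∈ Finset.range n, C (entryPoly k) * X ^ k

open Polynomial in
/-- The `x`-derivative of `entrySum n`. -/
noncomputable def entrySumDeriv (n : ℕ) : ℂ[X][X] :=
  ∑ k ∈ Finset.range n, C (derivative (entryPoly k)) * X ^ k

open Polynomial in
theorem coeff_sum_C_mul_X_pow {R : Type*} [Semiring R] (f : ℕ → R) (n d : ℕ) :
    (∑ k ∈ Finset.range n, C (f k) * X ^ k).coeff d = if d < n then f d else 0 := by
  simp [coeff_C_mul, coeff_X_pow]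

open Polynomial in
/-- The truncated sums satisfy the Riccati equation `u = x + τ ∂ₓu + τ² u²` up to the order of the
truncation. This is the recursion for `entryPoly`, read off coefficientwise. -/
theorem X_pow_dvd_riccati_entrySum (n : ℕ) :
    (X : ℂ[X][X]) ^ (n + 1) ∣
      C X + X * entrySumDeriv n + X ^ 2 * entrySum n ^ 2 - entrySum (n + 1) := by
  rw [X_pow_dvd_iff]
  intro d hd
  rw [coeff_sub, coeff_add, coeff_add, entrySum.eq_def (n + 1), coeff_sum_C_mul_X_pow,
    if_pos hd]
  match d with
  | 0 => simp [entryPoly, pow_two, mul_assoc]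
  | 1 =>
    have h0 : 0 < n := by omega
    rw [pow_two X, mul_assoc X X, coeff_X_mul, coeff_X_mul, entrySumDeriv, coeff_sum_C_mul_X_pow,
      if_pos h0, coeff_C]
    simp [entryPoly]
  | e + 2 =>
    have he : e + 1 < n := by omega
    rw [coeff_X_pow_mul, coeff_X_mul, entrySumDeriv, coeff_sum_C_mul_X_pow, if_pos he, coeff_C,
      if_neg (by omega), pow_two, coeff_mul, entrySum, entryPoly_succ (e + 1),
      Finset.Nat.sum_antidiagonal_eq_sum_range_succ_mk, zero_add, sub_eq_zero]
    congr 1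
    refine Finset.sum_congr rfl fun k hk => ?_
    rw [Finset.mem_range] at hk
    simp only [coeff_sum_C_mul_X_pow]
    rw [if_pos (by omega), if_pos (by omega)]
    rfl

theorem continuous_evalEval (Q : ℂ[X][X]) :
    Continuous fun p : ℂ × ℂ => Q.evalEval p.1 p.2 := by
  induction Q using Polynomial.induction_on' with
  | add p q hp hq =>
    simp only [Polynomial.evalEval_add]
    exact hp.add hq
  | monomial n a =>
    simp only [Polynomial.evalEval, Polynomial.eval_monomial, Polynomial.eval_mul,
      Polynomial.eval_pow, Polynomial.eval_C]
    exact (a.continuous.comp continuous_fst).mul (continuous_snd.pow n)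

theorem exists_norm_evalEval_le (Q : ℂ[X][X]) (ρ : ℝ) :
    ∃ M, ∀ x τ : ℂ, ‖x‖ ≤ ρ → ‖τ‖ ≤ 1 → ‖Q.evalEval x τ‖ ≤ M := by
  obtain ⟨M, hM⟩ := ((isCompact_closedBall (0 : ℂ) ρ).prod
    (isCompact_closedBall (0 : ℂ) 1)).exists_bound_of_continuousOn
      (continuous_evalEval Q).continuousOn
  exact ⟨M, fun x τ hx hτ => hM (x, τ) (by simp [hx, hτ])⟩

theorem evalEval_entrySum (n : ℕ) (x τ : ℂ) :
    (entrySum n).evalEval x τ = ∑ k ∈ Finset.range n, (entryPoly k).eval x * τ ^ k := by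
  simp [entrySum, Polynomial.evalEval, Polynomial.eval_finsetSum]

theorem hasDerivAt_evalEval_entrySum (n : ℕ) (x τ : ℂ) :
    HasDerivAt (fun x => (entrySum n).evalEval x τ) ((entrySumDeriv n).evalEval x τ) x := by
  simp only [evalEval_entrySum]
  have : (entrySumDeriv n).evalEval x τ =
      ∑ k ∈ Finset.range n, (Polynomial.derivative (entryPoly k)).eval x * τ ^ k := by
    simp [entrySumDeriv, Polynomial.evalEval, Polynomial.eval_finsetSum]
  rw [this]
  exact HasDerivAt.fun_sum fun k _ => ((entryPoly k).hasDerivAt x).mul_const _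

/-- The remainders are of the right order, uniformly for bounded `x`. The induction step feeds the
bound for order `n` into the Riccati equation; the `x`-derivative of the remainder is controlled on
a smaller disc by the Cauchy estimate. -/
theorem exists_norm_thetaLogDeriv_sub_le {δ : ℝ} (hδ : 0 < δ) (n : ℕ) :
    ∀ {ρ : ℝ}, 0 ≤ ρ → ∃ R M : ℝ, ∀ t x : ℂ, R ≤ ‖t‖ → δ * ‖t‖ ≤ t.re → ‖x‖ ≤ ρ →
      ‖thetaLogDeriv t x - (entrySum n).evalEval x (-2 * t)⁻¹‖ ≤ M * ‖(-2 * t)⁻¹‖ ^ n := by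
  induction n with
  | zero =>
    intro ρ hρ
    obtain ⟨R, M, h⟩ := exists_norm_thetaLogDeriv_le hδ hρ
    exact ⟨R, M, fun t x hR ht hx => by simpa [entrySum] using (h t x hR ht hx).2⟩
  | succ n ih =>
    intro ρ hρ
    obtain ⟨R₀, M₀, h₀⟩ := exists_norm_thetaLogDeriv_le hδ (add_nonneg hρ zero_le_two)
    obtain ⟨R₁, M₁, h₁⟩ := ih (add_nonneg hρ zero_le_one)
    obtain ⟨Q, hQ⟩ := X_pow_dvd_riccati_entrySum n
    obtain ⟨M₂, h₂⟩ := exists_norm_evalEval_le Q ρ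
    obtain ⟨M₃, h₃⟩ := exists_norm_evalEval_le (entrySum n) ρ
    refine ⟨max 1 (max R₀ R₁), M₂ + M₁ + M₁ * (M₀ + M₃), fun t x hR ht hx => ?_⟩
    have ht1 : 1 ≤ ‖t‖ := (le_max_left _ _).trans hR
    have hR₀ : R₀ ≤ ‖t‖ := (le_max_left _ _).trans ((le_max_right _ _).trans hR)
    have hR₁ : R₁ ≤ ‖t‖ := (le_max_right _ _).trans ((le_max_right _ _).trans hR)
    have htre : 0 < t.re := lt_of_lt_of_le (by positivity) ht
    have hric : ∀ y : ℂ, ‖y‖ ≤ ρ + 2 → _ := fun y hy =>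
      thetaLogDeriv_riccati htre (h₀ t y hR₀ ht hy).1
    have hτ : ‖(-2 * t)⁻¹‖ ≤ 1 := by
      rw [norm_inv, norm_mul, norm_neg, Complex.norm_two]
      exact inv_le_one_of_one_le₀ (by linarith)
    set τ := (-2 * t)⁻¹
    set S := (entrySum n).evalEval x τ with hS
    set r : ℂ → ℂ := fun y => thetaLogDeriv t y - (entrySum n).evalEval y τ with hr
    -- Cauchy estimate on the unit disc around `x`
    have hcauchy : ‖deriv r x‖ ≤ M₁ * ‖τ‖ ^ n := by
      have := Complex.norm_deriv_le_of_forall_mem_sphere_norm_le (f := r) (c := x)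
        (C := M₁ * ‖τ‖ ^ n) zero_lt_one ?_ ?_
      · simpa using this
      · apply DifferentiableOn.diffContOnCl
        rw [closure_ball x one_ne_zero]
        intro y hy
        have hy' : ‖y‖ ≤ ρ + 2 := by
          have := norm_le_norm_add_norm_sub' y x
          rw [Metric.mem_closedBall, dist_eq_norm] at hy
          linarith
        exact ((hric y hy').1.sub
          (hasDerivAt_evalEval_entrySum n y τ).differentiableAt).differentiableWithinAt
      · intro y hy
        refine h₁ t y hR₁ ht ?_
        have := norm_le_norm_add_norm_sub' y x
        rw [mem_sphere_iff_norm] at hy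
        linarith
    have hx2 : ‖x‖ ≤ ρ + 2 := by linarith
    obtain ⟨hdiff, heq⟩ := hric x hx2
    have hderiv : deriv (thetaLogDeriv t) x = (entrySumDeriv n).evalEval x τ + deriv r x := by
      have := (hdiff.hasDerivAt.sub (hasDerivAt_evalEval_entrySum n x τ)).deriv
      rw [show r = thetaLogDeriv t - fun x => (entrySum n).evalEval x τ from rfl, this]
      ring
    have hpoly := congrArg (Polynomial.evalEval x τ) hQ
    simp only [Polynomial.evalEval_sub, Polynomial.evalEval_add, Polynomial.evalEval_mul,
      Polynomial.evalEval_pow, Polynomial.evalEval_X, Polynomial.evalEval_C,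
      Polynomial.eval_X] at hpoly
    have hmain : thetaLogDeriv t x - (entrySum (n + 1)).evalEval x τ =
        τ ^ (n + 1) * Q.evalEval x τ + τ * deriv r x +
          τ ^ 2 * (r x * (thetaLogDeriv t x + S)) := by
      rw [hderiv] at heq
      simp only [hr]
      linear_combination heq + hpoly
    have hrx : ‖r x‖ ≤ M₁ * ‖τ‖ ^ n := h₁ t x hR₁ ht (by linarith)
    have hsum : ‖thetaLogDeriv t x + S‖ ≤ M₀ + M₃ :=
      norm_add_le_of_le (h₀ t x hR₀ ht hx2).2 (h₃ x τ hx hτ)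
    have hM₁ : 0 ≤ M₁ * ‖τ‖ ^ n := (norm_nonneg _).trans hrx
    have hM₀ : 0 ≤ M₀ + M₃ := (norm_nonneg _).trans hsum
    rw [hmain]
    calc _ ≤ ‖τ‖ ^ (n + 1) * M₂ + ‖τ‖ * (M₁ * ‖τ‖ ^ n) +
          ‖τ‖ * (M₁ * ‖τ‖ ^ n * (M₀ + M₃)) := by
          refine norm_add₃_le.trans ?_
          simp only [norm_mul, norm_pow]
          gcongr
          · exact h₂ x τ hx hτ
          · exact pow_le_of_le_one (norm_nonneg _) hτ two_ne_zero
      _ = _ := by ring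

/-! ### The sector -/

/-- A closed subsector of `|arg t| < π / 2` lies in a cone `δ |t| ≤ Re t`. -/
theorem exists_mul_norm_le_re_of_mem_closedSector {α β : ℝ} (hα : -(π / 2) < α) (hβ : β < π / 2) :
    ∃ δ : ℝ, 0 < δ ∧ ∀ t ∈ closedSector α β, δ * ‖t‖ ≤ t.re := by
  have hγ : max 0 (max (-α) β) < π / 2 :=
    max_lt (by positivity) (max_lt (by linarith) hβ)
  refine ⟨Real.cos (max 0 (max (-α) β)), Real.cos_pos_of_mem_Ioo
    ⟨lt_of_lt_of_le (by linarith [Real.pi_pos]) (le_max_left _ _), hγ⟩, fun t ht => ?_⟩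
  have harg : |t.arg| ≤ max 0 (max (-α) β) :=
    (abs_le'.2 ⟨ht.2.2.trans (le_max_right _ _), (neg_le_neg ht.2.1).trans (le_max_left _ _)⟩).trans
      (le_max_right _ _)
  have hcos := Real.cos_le_cos_of_nonneg_of_le_pi (abs_nonneg _)
    (by linarith [Real.pi_pos]) harg
  rw [Real.cos_abs] at hcos
  rw [← Complex.norm_mul_cos_arg t, mul_comm]
  gcongr

theorem eventually_norm_ge_toInfinityWithin (S : Set ℂ) (R : ℝ) :
    ∀ᶠ t in toInfinityWithin S, R ≤ ‖t‖ ∧ t ∈ S :=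
  ((tendsto_norm_cobounded_atTop.eventually_ge_atTop R).filter_mono inf_le_left).and
    (Filter.eventually_inf_principal.2 (Filter.Eventually.of_forall fun _ h => h))

theorem tendsto_inv_neg_two_mul_toInfinityWithin (S : Set ℂ) :
    Filter.Tendsto (fun t : ℂ => (-2 * t)⁻¹) (toInfinityWithin S) (nhds 0) := by
  have h : Filter.Tendsto (fun t : ℂ => t⁻¹) (toInfinityWithin S) (nhds 0) :=
    Filter.tendsto_inv₀_cobounded.mono_left inf_le_left
  simpa [mul_inv, mul_comm] using h.const_mul (-2 : ℂ)⁻¹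

theorem theorem1 :
    Differentiable ℂ (fun p : ℂ × ℂ => airyTheta p.1 p.2) ∧
    ∀ (x : ℂ) (α β : ℝ), -(π / 2) < α → β < π / 2 →
      (∀ᶠ t in toInfinityWithin (closedSector α β), airyTheta x t ≠ 0) ∧
      HasAsymptoticExpansion (toInfinityWithin (closedSector α β))
        (fun t : ℂ => logDeriv (fun u : ℂ => airyTheta x u) t)
        (fun n : ℕ => (entryPoly n).eval x)
        (fun (n : ℕ) (t : ℂ) => (-2 * t) ^ (-(n : ℤ))) := by
  refine ⟨differentiable_airyTheta, fun x α β hα hβ => ?_⟩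
  obtain ⟨δ, hδ, hsec⟩ := exists_mul_norm_le_re_of_mem_closedSector hα hβ
  obtain ⟨R, _, hne⟩ := exists_norm_thetaLogDeriv_le hδ (norm_nonneg x)
  have hre : ∀ t ∈ closedSector α β, 0 < t.re := fun t ht =>
    lt_of_lt_of_le (mul_pos hδ (norm_pos_iff.2 ht.1)) (hsec t ht)
  constructor
  · filter_upwards [eventually_norm_ge_toInfinityWithin _ R] with t ht
    rw [airyTheta_eq_airyMoment x (hre t ht.2)]
    have hpi : (π : ℂ) ≠ 0 := by exact_mod_cast Real.pi_ne_zero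
    exact mul_ne_zero (by simp [hpi])
      (mul_ne_zero (Complex.exp_ne_zero _) (hne t x ht.1 (hsec t ht.2) le_rfl).1)
  · intro N
    obtain ⟨R', M, hM⟩ := exists_norm_thetaLogDeriv_sub_le hδ (N + 1) (norm_nonneg x)
    have hbig : (fun t => logDeriv (fun u : ℂ => airyTheta x u) t -
        ∑ n ∈ Finset.range (N + 1), (entryPoly n).eval x * (-2 * t) ^ (-(n : ℤ)))
          =O[toInfinityWithin (closedSector α β)] fun t => (-2 * t)⁻¹ ^ (N + 1) := by
      refine Asymptotics.IsBigO.of_bound M ?_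
      filter_upwards [eventually_norm_ge_toInfinityWithin (closedSector α β) R,
        eventually_norm_ge_toInfinityWithin (closedSector α β) R'] with t ht ht'
      rw [logDeriv_airyTheta x (hre t ht.2) (hne t x ht.1 (hsec t ht.2) le_rfl).1, norm_pow]
      have := hM t x ht'.1 (hsec t ht.2) le_rfl
      rw [evalEval_entrySum] at this
      simpa only [zpow_neg, zpow_natCast, inv_pow] using this
    refine hbig.trans_isLittleO ?_
    have hlit := (Asymptotics.isLittleO_pow_pow (𝕜 := ℂ) (Nat.lt_succ_self N)).comp_tendsto
      (tendsto_inv_neg_two_mul_toInfinityWithin (closedSector α β))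
    simpa only [Function.comp_def, zpow_neg, zpow_natCast, inv_pow] using hlit
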